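/- A tournament is an orientation of a finite complete graph; it is regular if it has some order $n$ and every vertex has out-degree $(n-1)/2$. A regular tournament is called doubly-regular if, for each vertex, the subtournaments induced by its out-set and by its in-set are both regular. A cycle of length $m$ is a directed cycle with $m$ distinct vertices. Let $t\ge 0$ be an integer and $n=4t+3$. Then: (1) every arc of every doubly-regular tournament of order $n$ lies on exactly $2(t+1)(t-1)t^2(16t^2-4t-11)$ cycles of length $8$ (so this number depends neither on the arc nor on the choice of the tournament); (2) any two doubly-regular tournaments of order $n$ have the same number $c_8$ of cycles of length $8$, and every arc of such a tournament lies on $\frac{2\cdot 8\cdot c_8}{n(n-1)}$ cycles of length $8$. -/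

import Mathlib

namespace Digraph

variable {V : Type*}

/-- A tournament: an orientation of the complete graph on the vertex set, that is, there are no
loops and exactly one of `(u, v)`, `(v, u)` is an arc whenever `u ≠ v`. -/
def IsTournament (T : Digraph V) : Prop :=
  (∀ v, ¬ T.Adj v v) ∧ ∀ u v, u ≠ v → (T.Adj u v ↔ ¬ T.Adj v u)

/-- The out-set of `v`: the vertices dominated by `v`. -/
def outSet (T : Digraph V) (v : V) : Set V := {w | T.Adj v w}

/-- The in-set of `v`: the vertices dominating `v`. -/
def inSet (T : Digraph V) (v : V) : Set V := {w | T.Adj w v}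

/-- The subdigraph induced by a set of vertices. -/
def restrict (T : Digraph V) (s : Set V) : Digraph s where
  Adj a b := T.Adj a b

/-- A regular tournament: a tournament of some order `n` in which every out-degree is
`(n - 1) / 2`. -/
def IsRegularTournament (T : Digraph V) : Prop :=
  T.IsTournament ∧ ∀ v, 2 * (T.outSet v).ncard + 1 = Nat.card V

/-- A doubly-regular tournament: a regular tournament such that the out-set and the in-set of each
vertex induce regular tournaments. -/
def IsDoublyRegularTournament (T : Digraph V) : Prop :=
  T.IsRegularTournament ∧
    ∀ v, (T.restrict (T.outSet v)).IsRegularTournament ∧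
      (T.restrict (T.inSet v)).IsRegularTournament

/-- The directed cycles of length `m` in `T`: cyclic sequences (lists up to rotation) of `m`
distinct vertices in which each vertex dominates its cyclic successor. -/
def cyclesOfLength (T : Digraph V) (m : ℕ) : Set (Cycle V) :=
  {c | c.Nodup ∧ c.length = m ∧ c.Chain T.Adj}

/-- The directed cycles of length `m` in `T` that contain the arc `(u, v)`: those in which `v` is
the immediate successor of `u`. -/
def cyclesThroughArc (T : Digraph V) (m : ℕ) (u v : V) : Set (Cycle V) :=
  {c | c ∈ T.cyclesOfLength m ∧ ∃ l : List V, c = ((u :: v :: l : List V) : Cycle V)}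

end Digraph

/-! Double regularity makes the span of `1`, `A`, `Aᵀ` closed under matrix multiplication and
entrywise products, with structure constants polynomial in `t`. The number of 8-cycles through `u →
v` is a sum over six further vertices of a product of such matrix entries, one for each pair of
vertices: arcs along the cycle, `J - 1` for the other pairs.

Vertices are summed out one at a time. A symmetric entry is a multiple of `J` plus a multiple of
`1`; the latter identifies two vertices. If at most two asymmetric entries remain at a vertex, its
sum is a constant, a row sum or an entry of a matrix product, so it leaves a weight on older pairs.
`sum_eliminate` is this step and `stackSum_eq_evaluate` its iteration.

The computation `evaluate_cycleTable` shows that the process never gets stuck for length 8 and gives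
a polynomial in `t` alone. Double counting of cycles and arcs (`sum_ncard_cyclesThroughArc`) yields
the total. -/

/-! ### Integer polynomials as coefficient lists -/

namespace CoeffList

/-- Prepend a coefficient, keeping the list free of trailing zeros. -/
def cons (a : ℤ) (p : List ℤ) : List ℤ := if a = 0 ∧ p = [] then [] else a :: p

def add : List ℤ → List ℤ → List ℤ
  | [], q => q
  | a :: p, [] => a :: p
  | a :: p, b :: q => cons (a + b) (add p q)

def smul (a : ℤ) : List ℤ → List ℤ
  | [] => []
  | b :: q => cons (a * b) (smul a q)

def mul : List ℤ → List ℤ → List ℤ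
  | [], _ => []
  | a :: p, q => add (smul a q) (cons 0 (mul p q))

def eval (t : ℤ) : List ℤ → ℤ
  | [] => 0
  | a :: p => a + t * eval t p

@[simp] theorem eval_nil (t : ℤ) : eval t [] = 0 := rfl

@[simp] theorem eval_list_cons (t a : ℤ) (p : List ℤ) : eval t (a :: p) = a + t * eval t p := rfl

@[simp] theorem eval_cons (t a : ℤ) (p : List ℤ) : eval t (cons a p) = a + t * eval t p := by
  unfold cons
  split_ifs with h
  · simp [h.1, h.2]
  · rfl

@[simp] theorem eval_add (t : ℤ) (p q : List ℤ) : eval t (add p q) = eval t p + eval t q := by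
  induction p generalizing q with
  | nil => simp [add]
  | cons a p ih =>
    cases q with
    | nil => simp [add]
    | cons b q => simp only [add, eval_cons, ih, eval_list_cons]; ring

@[simp] theorem eval_smul (t a : ℤ) (q : List ℤ) : eval t (smul a q) = a * eval t q := by
  induction q with
  | nil => simp [smul]
  | cons b q ih => simp only [smul, eval_cons, ih, eval_list_cons]; ring

@[simp] theorem eval_mul (t : ℤ) (p q : List ℤ) : eval t (mul p q) = eval t p * eval t q := by
  induction p with
  | nil => simp [mul]
  | cons a p ih => simp only [mul, eval_add, eval_smul, eval_cons, ih, eval_list_cons]; ring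

end CoeffList

/-! ### The two-class association scheme of a doubly-regular tournament -/

/-- A matrix `diag • 1 + fwd • A + bwd • Aᵀ`, where `A` is the adjacency matrix of a doubly-regular
tournament of order `4 * t + 3`; the coefficients are polynomials in `t`. -/
structure Weight where
  diag : List ℤ
  fwd : List ℤ
  bwd : List ℤ
  deriving DecidableEq

namespace Weight

open CoeffList

def transpose (s : Weight) : Weight := ⟨s.diag, s.bwd, s.fwd⟩

def hadamard (s r : Weight) : Weight :=
  ⟨CoeffList.mul s.diag r.diag, CoeffList.mul s.fwd r.fwd, CoeffList.mul s.bwd r.bwd⟩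

/-- `[1, 2]` is `1 + 2 * t`, the common in- and out-degree. -/
def rowSum (s : Weight) : List ℤ := add s.diag (CoeffList.mul [1, 2] (add s.fwd s.bwd))

/-- The matrix product. -/
def mul (s r : Weight) : Weight :=
  -- Structure constants: `A * Aᵀ = Aᵀ * A = (2t+1) + t A + t Aᵀ` and `A * A = t A + (t+1) Aᵀ`.
  let c := add (CoeffList.mul s.fwd r.bwd) (CoeffList.mul s.bwd r.fwd)
  let f := CoeffList.mul s.fwd r.fwd
  let b := CoeffList.mul s.bwd r.bwd
  { diag := add (CoeffList.mul s.diag r.diag) (CoeffList.mul [1, 2] c)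
    fwd := add (add (CoeffList.mul s.diag r.fwd) (CoeffList.mul s.fwd r.diag))
      (add (CoeffList.mul [0, 1] (add f c)) (CoeffList.mul [1, 1] b))
    bwd := add (add (CoeffList.mul s.diag r.bwd) (CoeffList.mul s.bwd r.diag))
      (add (CoeffList.mul [0, 1] (add b c)) (CoeffList.mul [1, 1] f)) }

/-- The matrix is a combination of the identity and the all-ones matrix. -/
def IsSymm (s : Weight) : Prop := s.fwd = s.bwd

instance (s : Weight) : Decidable s.IsSymm := inferInstanceAs (Decidable (s.fwd = s.bwd))

/-- The multiple of the all-ones matrix that agrees off the diagonal, for a symmetric weight. -/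
def flatten (s : Weight) : Weight := if s.IsSymm then ⟨s.fwd, s.fwd, s.fwd⟩ else s

def arc : Weight := ⟨[], [1], []⟩

def coarc : Weight := ⟨[], [], [1]⟩

def distinct : Weight := ⟨[], [1], [1]⟩

open Classical in
/-- The entries of the matrix that a weight stands for. -/
noncomputable def entry {V : Type*} (T : Digraph V) (t : ℤ) (s : Weight) (x y : V) : ℤ :=
  if x = y then eval t s.diag else if T.Adj x y then eval t s.fwd else eval t s.bwd

end Weight

/-! ### Multiplication table of the adjacency matrix and its transpose. -/

namespace Digraph

variable {V : Type*} {T : Digraph V}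

theorem IsTournament.not_adj_of_adj (h : T.IsTournament) {u v : V} (huv : T.Adj u v) :
    ¬ T.Adj v u := by
  have hne : u ≠ v := by rintro rfl; exact h.1 _ huv
  exact (h.2 u v hne).1 huv

theorem IsTournament.ne_of_adj (h : T.IsTournament) {u v : V} (huv : T.Adj u v) : u ≠ v := by
  rintro rfl; exact h.1 _ huv

open Classical in
/-- The adjacency matrix with integer entries. -/
noncomputable def adjInt (T : Digraph V) : Matrix V V ℤ :=
  Matrix.of fun x y => if T.Adj x y then 1 else 0

open Matrix

theorem IsTournament.adjInt_add_transpose [DecidableEq V] (h : T.IsTournament) :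
    T.adjInt + T.adjIntᵀ + 1 = Matrix.of fun _ _ => (1 : ℤ) := by
  ext x y
  by_cases hxy : x = y
  · subst hxy; simp [adjInt, h.1 x]
  · have := h.2 x y hxy
    by_cases h' : T.Adj x y <;> simp_all [adjInt]

theorem restrict_outSet_ncard (T : Digraph V) (s : Set V) (a : s) :
    ((T.restrict s).outSet a).ncard = (T.outSet a ∩ s).ncard := by
  rw [← Set.ncard_image_of_injective _ (Subtype.val_injective (p := (· ∈ s)))]
  congr 1
  ext x
  simp only [outSet, restrict, Set.mem_image, Set.mem_ofPred_eq, Subtype.exists, exists_and_right,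
    exists_eq_right, Set.mem_inter_iff]
  constructor
  · rintro ⟨h1, h2⟩; exact ⟨h2, h1⟩
  · rintro ⟨h1, h2⟩; exact ⟨h2, h1⟩

variable [Fintype V] {t : ℕ}

theorem IsRegularTournament.ncard_outSet (h : T.IsRegularTournament)
    (hn : Fintype.card V = 4 * t + 3) (v : V) : (T.outSet v).ncard = 2 * t + 1 := by
  have := h.2 v
  rw [Nat.card_eq_fintype_card] at this
  omega

/-- If `u → v`, then `v` is a vertex of the regular tournament of order `2t+1` on the out-set of
`u`, so its out-degree there is `t`. -/
theorem IsDoublyRegularTournament.ncard_outSet_inter (h : T.IsDoublyRegularTournament)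
    (hn : Fintype.card V = 4 * t + 3) {u v : V} (huv : u ≠ v) :
    (T.outSet u ∩ T.outSet v).ncard = t := by
  wlog hadj : T.Adj u v generalizing u v
  · rw [Set.inter_comm]
    exact this huv.symm (by have := h.1.1.2 u v huv; tauto)
  have h1 := (h.2 u).1.2 ⟨v, hadj⟩
  rw [restrict_outSet_ncard, Nat.card_coe_set_eq, h.1.ncard_outSet hn, Set.inter_comm] at h1
  simp only at h1
  omega

theorem adjInt_mul_transpose_apply (T : Digraph V) (u v : V) :
    (T.adjInt * T.adjIntᵀ) u v = (T.outSet u ∩ T.outSet v).ncard := by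
  classical
  rw [Set.ncard_eq_toFinset_card', Matrix.mul_apply]
  simp only [adjInt, Matrix.of_apply, Matrix.transpose_apply, ← ite_and, mul_ite, mul_one, mul_zero]
  rw [Finset.sum_boole]
  congr 2
  ext z
  rw [Set.mem_toFinset, Finset.mem_filter]
  exact ⟨fun h => h.2.symm, fun h => ⟨Finset.mem_univ _, h.symm⟩⟩

theorem IsRegularTournament.adjInt_mul_ones (h : T.IsRegularTournament)
    (hn : Fintype.card V = 4 * t + 3) :
    T.adjInt * (Matrix.of fun _ _ => (1 : ℤ)) = (2 * t + 1 : ℤ) • Matrix.of fun _ _ => (1 : ℤ) := by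
  classical
  ext u v
  have := h.ncard_outSet hn u
  rw [Set.ncard_eq_toFinset_card'] at this
  have h2 : (∑ z, if T.Adj u z then (1 : ℤ) else 0) = 2 * t + 1 := by
    rw [Finset.sum_boole]
    have : (Finset.univ.filter fun z => T.Adj u z).card = 2 * t + 1 := by
      rw [← this]; congr 1; ext; rw [Set.mem_toFinset, Finset.mem_filter]; simp [outSet]
    exact_mod_cast this
  simp [adjInt, Matrix.mul_apply, h2]

theorem IsRegularTournament.ones_mul_adjInt (h : T.IsRegularTournament)
    (hn : Fintype.card V = 4 * t + 3) :
    (Matrix.of fun _ _ => (1 : ℤ)) * T.adjInt = (2 * t + 1 : ℤ) • Matrix.of fun _ _ => (1 : ℤ) := by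
  classical
  have h1 := h.adjInt_mul_ones hn
  have h2 := h.1.adjInt_add_transpose
  set J : Matrix V V ℤ := Matrix.of fun _ _ => (1 : ℤ) with hJ
  have hJt : Jᵀ = J := by ext; simp [hJ]
  have hJJ : J * J = (4 * t + 3 : ℤ) • J := by
    ext; simp [hJ, Matrix.mul_apply, hn]
  have h3 : J * T.adjIntᵀ = (2 * t + 1 : ℤ) • J := by
    rw [← hJt, ← Matrix.transpose_mul, h1, Matrix.transpose_smul]
  have h4 : J * (T.adjInt + T.adjIntᵀ + 1) = (4 * t + 3 : ℤ) • J := by rw [h2, hJJ]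
  rw [mul_add, mul_add, h3, mul_one] at h4
  calc J * T.adjInt = (J * T.adjInt + (2 * t + 1 : ℤ) • J + J) - (2 * t + 1 : ℤ) • J - J := by abel
    _ = _ := by rw [h4]; module

theorem IsDoublyRegularTournament.adjInt_mul_transpose [DecidableEq V]
    (h : T.IsDoublyRegularTournament) (hn : Fintype.card V = 4 * t + 3) :
    T.adjInt * T.adjIntᵀ =
      (2 * t + 1 : ℤ) • 1 + (t : ℤ) • T.adjInt + (t : ℤ) • T.adjIntᵀ := by
  have h2 := h.1.1.adjInt_add_transpose
  have : T.adjInt * T.adjIntᵀ =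
      (t + 1 : ℤ) • 1 + (t : ℤ) • Matrix.of fun _ _ => (1 : ℤ) := by
    ext u v
    rw [adjInt_mul_transpose_apply]
    by_cases huv : u = v
    · subst huv
      rw [Set.inter_self, h.1.ncard_outSet hn]
      simp only [Matrix.add_apply, Matrix.smul_apply, Matrix.one_apply_eq, Matrix.of_apply]
      push_cast; simp only [smul_eq_mul]; ring
    · rw [h.ncard_outSet_inter hn huv]
      simp only [Matrix.add_apply, Matrix.smul_apply, Matrix.one_apply_ne huv, Matrix.of_apply]
      simp only [smul_eq_mul]; ring
  rw [this, ← h2]; module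

/-- Expand `A * J = (2t+1) J` with `J = A + Aᵀ + 1` and cancel the known product `A * Aᵀ`. -/
theorem IsDoublyRegularTournament.adjInt_mul_self (h : T.IsDoublyRegularTournament)
    (hn : Fintype.card V = 4 * t + 3) :
    T.adjInt * T.adjInt = (t : ℤ) • T.adjInt + (t + 1 : ℤ) • T.adjIntᵀ := by
  classical
  have h1 := h.1.adjInt_mul_ones hn
  rw [← h.1.1.adjInt_add_transpose, mul_add, mul_add, h.adjInt_mul_transpose hn, mul_one] at h1
  calc _ = (T.adjInt * T.adjInt + ((2 * t + 1 : ℤ) • 1 + (t : ℤ) • T.adjInt + (t : ℤ) • T.adjIntᵀ)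
        + T.adjInt) - ((2 * t + 1 : ℤ) • 1 + (t : ℤ) • T.adjInt + (t : ℤ) • T.adjIntᵀ)
        - T.adjInt := by abel
    _ = _ := by rw [h1]; module

theorem IsDoublyRegularTournament.transpose_mul_adjInt [DecidableEq V]
    (h : T.IsDoublyRegularTournament) (hn : Fintype.card V = 4 * t + 3) :
    T.adjIntᵀ * T.adjInt =
      (2 * t + 1 : ℤ) • 1 + (t : ℤ) • T.adjInt + (t : ℤ) • T.adjIntᵀ := by
  have h1 := h.1.ones_mul_adjInt hn
  rw [← h.1.1.adjInt_add_transpose, add_mul, add_mul, h.adjInt_mul_self hn, one_mul] at h1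
  calc _ = ((t : ℤ) • T.adjInt + (t + 1 : ℤ) • T.adjIntᵀ + T.adjIntᵀ * T.adjInt + T.adjInt)
        - ((t : ℤ) • T.adjInt + (t + 1 : ℤ) • T.adjIntᵀ) - T.adjInt := by abel
    _ = _ := by rw [h1]; module

theorem IsDoublyRegularTournament.transpose_mul_transpose (h : T.IsDoublyRegularTournament)
    (hn : Fintype.card V = 4 * t + 3) :
    T.adjIntᵀ * T.adjIntᵀ = (t + 1 : ℤ) • T.adjInt + (t : ℤ) • T.adjIntᵀ := by
  rw [← Matrix.transpose_mul, h.adjInt_mul_self hn]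
  simp [Matrix.transpose_smul, add_comm]

end Digraph

/-! ### Weights as matrices: entrywise products, matrix products and row sums. -/

namespace Weight

open CoeffList Matrix

variable {V : Type*} {T : Digraph V} {t : ℤ}

theorem entry_transpose (hT : T.IsTournament) (s : Weight) (x y : V) :
    s.transpose.entry T t x y = s.entry T t y x := by
  unfold entry transpose
  by_cases hxy : x = y
  · simp [hxy]
  · have := hT.2 x y hxy
    by_cases h : T.Adj x y <;> simp_all [Ne.symm hxy]

theorem entry_hadamard (s r : Weight) (x y : V) :
    (s.hadamard r).entry T t x y = s.entry T t x y * r.entry T t x y := by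
  unfold entry hadamard
  split_ifs <;> simp

theorem entry_eq_matrix [DecidableEq V] (hT : T.IsTournament) (s : Weight) (x y : V) :
    s.entry T t x y = (eval t s.diag • (1 : Matrix V V ℤ) + eval t s.fwd • T.adjInt +
      eval t s.bwd • T.adjIntᵀ) x y := by
  by_cases hxy : x = y
  · subst hxy; simp [entry, Digraph.adjInt, hT.1 x, -zsmul_one]
  · have := hT.2 x y hxy
    by_cases h : T.Adj x y <;> simp_all [entry, Digraph.adjInt, -zsmul_one]

variable [Fintype V]

theorem sum_entry_mul_entry {t : ℕ} (hT : T.IsDoublyRegularTournament)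
    (hn : Fintype.card V = 4 * t + 3) (s r : Weight) (x y : V) :
    ∑ z, s.entry T t x z * r.entry T t z y = (s.mul r).entry T t x y := by
  classical
  simp only [entry_eq_matrix hT.1.1]
  rw [← Matrix.mul_apply]
  refine congrArg (fun M : Matrix V V ℤ => M x y) ?_
  simp only [add_mul, mul_add, smul_mul_smul_comm, hT.adjInt_mul_self hn,
    hT.adjInt_mul_transpose hn, hT.transpose_mul_adjInt hn, hT.transpose_mul_transpose hn,
    mul_one, one_mul, mul, eval_add, eval_mul, eval_list_cons, eval_nil]
  module

theorem sum_entry {t : ℕ} (hT : T.IsDoublyRegularTournament)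
    (hn : Fintype.card V = 4 * t + 3) (s : Weight) (y : V) :
    ∑ x, s.entry T t x y = eval t s.rowSum := by
  classical
  have h1 := hT.1.ones_mul_adjInt hn
  have h2 := congrArg Matrix.transpose (hT.1.adjInt_mul_ones hn)
  rw [Matrix.transpose_mul] at h2
  have e1 := congrFun (congrFun h1 y) y
  have e2 := congrFun (congrFun h2 y) y
  simp [Matrix.mul_apply] at e1 e2
  simp only [entry_eq_matrix hT.1.1, Matrix.add_apply, Matrix.smul_apply, Matrix.one_apply,
    Matrix.transpose_apply, Finset.sum_add_distrib, ← Finset.smul_sum, e1, e2]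
  simp [rowSum]
  ring

omit [Fintype V] in
open Classical in
/-- Off the flat part, a symmetric weight only has diagonal entries. -/
theorem entry_eq_flatten (s : Weight) (x y : V) :
    s.entry T t x y = (if s.IsSymm ∧ x = y then eval t s.diag - eval t s.fwd else 0) +
      s.flatten.entry T t x y := by
  unfold entry flatten
  by_cases hs : s.IsSymm
  · have : s.bwd = s.fwd := hs.symm
    simp only [hs, true_and, if_true, this]
    split_ifs <;> ring
  · simp [hs]

end Weight

/-! ### Sums of products of pair weights, and their evaluation by eliminating vertices -/

/-- A table lists, for each vertex of a stack (newest first), its weights to the older vertices. -/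
abbrev WeightTable := List (List Weight)

namespace WeightTable

open CoeffList Weight

variable {V : Type*}

/-- Surplus weights or vertices contribute the factor `1`. -/
noncomputable def rowVal (T : Digraph V) (t : ℤ) : List Weight → V → List V → ℤ
  | s :: r, x, y :: e => s.entry T t x y * rowVal T t r x e
  | _, _, _ => 1

/-- The product of `rowVal` with the factor of the `j`-th older vertex left out. -/
noncomputable def rowValExcept (T : Digraph V) (t : ℤ) : ℕ → List Weight → V → List V → ℤ
  | 0, _ :: r, x, _ :: e => rowVal T t r x e
  | j + 1, s :: r, x, y :: e => s.entry T t x y * rowValExcept T t j r x e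
  | _, _, _, _ => 1

/-- The product of the weights of all pairs of vertices of a stack. -/
noncomputable def tableVal (T : Digraph V) (t : ℤ) : WeightTable → List V → ℤ
  | r :: R, x :: e => rowVal T t r x e * tableVal T t R e
  | _, _ => 1

/-- The triangular shape: one weight for each older vertex. `evaluate` tests it as it runs, so
preservation by the table operations need not be proved. -/
def wellFormed : WeightTable → Bool
  | [] => true
  | r :: R => decide (r.length = R.length) && wellFormed R

def hadamardAt : ℕ → Weight → List Weight → List Weight
  | 0, s, r :: row => r.hadamard s :: row
  | j + 1, s, r :: row => r :: hadamardAt j s row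
  | _, _, [] => []

/-- Multiply the weight of the pair of vertices at positions `p < q` by `s`. -/
def mulPair : ℕ → ℕ → Weight → WeightTable → WeightTable
  | 0, q + 1, s, r :: R => hadamardAt q s r :: R
  | p + 1, q + 1, s, r :: R => r :: mulPair p q s R
  | _, _, _, R => R

/-- Identify a new vertex, with weights `row` to the vertices of the stack, with the one at position
`j`. -/
def absorb : ℕ → List Weight → WeightTable → WeightTable
  | 0, _ :: row, r :: R => List.zipWith Weight.hadamard r row :: R
  | j + 1, s :: row, r :: R => hadamardAt j s.transpose r :: absorb j row R
  | _, _, R => R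

/-- The contractions arising when the symmetric weights of a row are replaced by flat ones: a
coefficient, the position of the contracted vertex, and the row that remains. -/
def contractions : List Weight → List (List ℤ × ℕ × List Weight)
  | [] => []
  | s :: row =>
    let B := (contractions row).map fun b => (b.1, b.2.1 + 1, s.flatten :: b.2.2)
    if s.IsSymm ∧ s.diag ≠ s.fwd then
      -- Telescoping: weights before the contracted position are already flat, later ones are
      -- untouched. The entry `s` only holds the place.
      (add s.diag (smul (-1) s.fwd), 0, s :: row) :: B
    else B

/-- The product of the flat weights of a row, and the positions of the other ones. -/
def collect : List Weight → List ℤ × List (ℕ × Weight)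
  | [] => ([1], [])
  | s :: row =>
    let c := collect row
    let h := c.2.map fun b => (b.1 + 1, b.2)
    if s.IsSymm then (CoeffList.mul s.fwd c.1, h) else (c.1, (0, s) :: h)

/-- The sum over a vertex whose symmetric weights are flat, if at most two others remain. -/
def sumFlat (R : WeightTable) : List ℤ × List (ℕ × Weight) → Option (List (List ℤ × WeightTable))
  -- A vanishing coefficient kills the sum, however many asymmetric weights remain. Below, `[3, 4]`
  -- is the order `4t+3`, and two remaining weights combine to an entry of `sᵀ * r`.
  | ([], _) => some []
  | (c, []) => some [(CoeffList.mul c [3, 4], R)]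
  | (c, [(p, s)]) =>
    if p < R.length then some [(CoeffList.mul c s.rowSum, R)] else none
  | (c, [(p, s), (q, r)]) =>
    if p < q ∧ q < R.length then some [(c, mulPair p q (s.transpose.mul r) R)] else none
  | _ => none

/-- Sum out the newest vertex. -/
def eliminate : WeightTable → Option (List (List ℤ × WeightTable))
  | [] => none
  | row :: R => (sumFlat R (collect row)).map fun L =>
      (contractions row).map (fun b => (b.1, absorb b.2.1 b.2.2 R)) ++ L

def asymmCount : WeightTable → ℕ
  | [] => 0
  | row :: _ => row.countP fun s => decide (¬ s.IsSymm)

/-- Swap the two newest vertices. -/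
def swapTop : WeightTable → WeightTable
  | (s :: r₁) :: r₂ :: R => (s.transpose :: r₂) :: r₁ :: R
  | R => R

/-- Make the third newest vertex the newest. -/
def rotateTop : WeightTable → WeightTable
  | (s :: s' :: r₁) :: (s'' :: r₂) :: r₃ :: R =>
    (s'.transpose :: s''.transpose :: r₃) :: (s :: r₁) :: r₂ :: R
  | R => R

/-- Bring one of the newest vertices with at most two asymmetric weights to the top, where `k + 1`
vertices may be permuted. -/
def rearrange (k : ℕ) (R : WeightTable) : WeightTable :=
  if asymmCount R ≤ 2 ∨ k = 0 then R
  else if asymmCount (swapTop R) ≤ 2 ∨ k = 1 then swapTop R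
  else rotateTop R

def hasZero (R : WeightTable) : Bool := R.any fun r => r.any fun s => decide (s = ⟨[], [], []⟩)

/-- Sum out the `k` newest vertices, the two others being joined by an arc. -/
def evaluate : ℕ → WeightTable → Option (List ℤ)
  -- The final stack is `[v, u]` with `u → v`, so the entry at `(v, u)` is the backward coefficient.
  | 0, [[s], []] => some s.bwd
  | 0, _ => none
  | k + 1, R =>
    if wellFormed R then
      if hasZero R then some [] else
        let R' := rearrange k R
        if wellFormed R' then
          (eliminate R').bind fun L => L.foldr
            (fun b acc => (evaluate k b.2).bind fun p => acc.map fun q =>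
              add (CoeffList.mul b.1 p) q) (some [])
        else none
    else none

/-- The weights along the path of the stack, all vertices being distinct. -/
def pathTable : ℕ → WeightTable
  | 0 => [[]]
  | k + 1 => (coarc :: List.replicate k distinct) :: pathTable k

/-- The weights along a directed cycle on `k + 3` distinct vertices. -/
def cycleTable (k : ℕ) : WeightTable :=
  (coarc :: (List.replicate k distinct ++ [arc])) :: pathTable (k + 1)

/-- The value `some` certifies that every elimination succeeds; the list holds the coefficients of
the expanded product, from the constant term up. -/
theorem evaluate_cycleTable : evaluate 6 (cycleTable 5) = some [0, 0, 22, 8, -54, -8, 32] := by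
  decide +kernel

/-! ### Values of tables under the basic operations. -/

variable {T : Digraph V} {t : ℤ}

theorem rowVal_hadamardAt {j : ℕ} {s : Weight} {row : List Weight} {e : List V} {x y : V}
    (hy : e[j]? = some y) (hj : j < row.length) :
    rowVal T t (hadamardAt j s row) x e = s.entry T t x y * rowVal T t row x e := by
  induction j generalizing row e with
  | zero =>
    match row, e, hy, hj with
    | r :: row, z :: e, hy, _ =>
      obtain rfl : z = y := by simpa using hy
      simp only [hadamardAt, rowVal, entry_hadamard]; ring
  | succ j ih =>
    match row, e, hy, hj with
    | r :: row, z :: e, hy, hj =>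
      simp only [hadamardAt, rowVal]
      rw [ih (by simpa using hy) (by simpa using hj)]; ring

theorem rowVal_zipWith {r r' : List Weight} (h : r.length = r'.length) (x : V) (e : List V) :
    rowVal T t (List.zipWith Weight.hadamard r r') x e = rowVal T t r x e * rowVal T t r' x e := by
  induction r generalizing r' e with
  | nil => cases r' with
    | nil => simp [rowVal]
    | cons => simp at h
  | cons s r ih => cases r' with
    | nil => simp at h
    | cons s' r' => cases e with
      | nil => simp [rowVal]
      | cons y e =>
        simp only [List.zipWith_cons_cons, rowVal, entry_hadamard, ih (by simpa using h)]; ring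

theorem wellFormed_cons {r : List Weight} {R : WeightTable} :
    wellFormed (r :: R) = true ↔ r.length = R.length ∧ wellFormed R = true := by
  simp [wellFormed]

theorem tableVal_mulPair {p q : ℕ} {s : Weight} {R : WeightTable} {e : List V} {y z : V}
    (hR : wellFormed R) (hpq : p < q) (hq : q < R.length) (hy : e[p]? = some y)
    (hz : e[q]? = some z) :
    tableVal T t (mulPair p q s R) e = s.entry T t y z * tableVal T t R e := by
  induction p generalizing q R e with
  | zero =>
    match q, R, e, hR, hq, hy, hz with
    | q + 1, r :: R, w :: e, hR, hq, hy, hz =>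
      obtain rfl : w = y := by simpa using hy
      simp only [mulPair, tableVal]
      rw [rowVal_hadamardAt (by simpa using hz) (by
        rw [(wellFormed_cons.1 hR).1]; simpa using hq)]
      ring
  | succ p ih =>
    match q, R, e, hR, hpq, hq, hy, hz with
    | q + 1, r :: R, w :: e, hR, hpq, hq, hy, hz =>
      simp only [mulPair, tableVal]
      rw [ih (wellFormed_cons.1 hR).2 (by omega) (by simpa using hq) (by simpa using hy)
        (by simpa using hz)]
      ring

theorem tableVal_absorb (hT : T.IsTournament) {j : ℕ} {row : List Weight} {R : WeightTable}
    {e : List V} {y : V} (hR : wellFormed R) (hrow : row.length = R.length)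
    (he : e.length = R.length) (hy : e[j]? = some y) :
    tableVal T t (absorb j row R) e = rowValExcept T t j row y e * tableVal T t R e := by
  induction j generalizing row R e with
  | zero =>
    match row, R, e, hR, hrow, he, hy with
    | s :: row, r :: R, w :: e, hR, hrow, he, hy =>
      obtain rfl : w = y := by simpa using hy
      have := (wellFormed_cons.1 hR).1
      simp only [absorb, tableVal, rowValExcept]
      rw [rowVal_zipWith (by simp at hrow; omega)]
      ring
    | _, [], w :: e, _, _, he, _ => simp at he
    | _, _, [], _, _, _, hy => simp at hy
  | succ j ih =>
    match row, R, e, hR, hrow, he, hy with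
    | s :: row, r :: R, w :: e, hR, hrow, he, hy =>
      have h := wellFormed_cons.1 hR
      have hj : j < e.length := by
        have := (List.getElem?_eq_some_iff.1 hy).1
        simpa using this
      simp only [absorb, tableVal, rowValExcept]
      rw [rowVal_hadamardAt (by simpa using hy) (by simp at he; omega),
        ih h.2 (by simpa using hrow) (by simpa using he) (by simpa using hy), entry_transpose hT]
      ring
    | _, [], w :: e, _, _, he, _ => simp at he
    | _, _, [], _, _, _, hy => simp at hy

open Classical in
-- Each symmetric factor is flat plus diagonal. The product is expanded according to the first
-- position where the diagonal part is chosen.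
theorem rowVal_eq_contractions (row : List Weight) (x : V) (e : List V) :
    rowVal T t row x e =
      ((contractions row).map fun b => eval t b.1 *
        if e[b.2.1]? = some x then rowValExcept T t b.2.1 b.2.2 x e else 0).sum +
      rowVal T t (row.map Weight.flatten) x e := by
  induction row generalizing e with
  | nil => simp [contractions, rowVal]
  | cons s row ih =>
    cases e with
    | nil => simp [rowVal]
    | cons y e =>
      have h1 : ((contractions row).map fun b => eval t b.1 *
          if (y :: e)[b.2.1 + 1]? = some x then
            rowValExcept T t (b.2.1 + 1) (s.flatten :: b.2.2) x (y :: e) else 0).sum =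
          s.flatten.entry T t x y * ((contractions row).map fun b => eval t b.1 *
            if e[b.2.1]? = some x then rowValExcept T t b.2.1 b.2.2 x e else 0).sum := by
        rw [← List.sum_map_mul_left]
        congr 2
        funext b
        simp only [List.getElem?_cons_succ, rowValExcept]
        split_ifs <;> ring
      have h2 := ih e
      have h3 := s.entry_eq_flatten (T := T) (t := t) x y
      rw [contractions]
      simp only [rowVal, List.map_cons]
      split_ifs with hs
      · simp only [List.map_cons, List.map_map, Function.comp_def, List.sum_cons]
        rw [h1]
        simp only [List.getElem?_cons_zero, rowValExcept, eval_add, eval_smul]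
        simp only [Option.some.injEq, hs.1, true_and, eq_comm (a := x)] at h3 ⊢
        rw [h3]
        split_ifs
        · linear_combination (s.flatten.entry T t x y) * h2
        · linear_combination (s.flatten.entry T t x y) * h2
      · simp only [List.map_map, Function.comp_def, h1]
        have h4 : s.entry T t x y = s.flatten.entry T t x y := by
          rw [h3]
          by_cases hsym : s.IsSymm
          · have : s.diag = s.fwd := by by_contra h; exact hs ⟨hsym, h⟩
            simp [this]
          · simp [hsym]
        rw [h4]
        linear_combination (s.flatten.entry T t x y) * h2

theorem rowVal_flatten (row : List Weight) (x : V) (e : List V) (he : e.length = row.length) :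
    rowVal T t (row.map Weight.flatten) x e = eval t (collect row).1 *
      ((collect row).2.map fun b => (e[b.1]?).elim 1 (b.2.entry T t x)).prod := by
  induction row generalizing e with
  | nil => simp [collect, rowVal]
  | cons s row ih =>
    match e, he with
    | y :: e, he =>
      have h2 := ih e (by simpa using he)
      simp only [collect, List.map_cons, rowVal, h2]
      split_ifs with hs
      · have : s.flatten.entry T t x y = eval t s.fwd := by
          simp [flatten, hs, entry]
        simp only [List.map_map, Function.comp_def, List.getElem?_cons_succ, eval_mul, this]
        ring
      · have : s.flatten = s := by simp [flatten, hs]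
        simp only [List.map_cons, List.map_map, Function.comp_def, List.getElem?_cons_succ, this,
          List.prod_cons, List.getElem?_cons_zero, Option.elim_some]
        ring

/-! ### Summing out vertices, and soundness of the evaluation. -/

section

variable [Fintype V] {t : ℕ}

theorem sum_sumFlat (hT : T.IsDoublyRegularTournament) (hn : Fintype.card V = 4 * t + 3)
    {R : WeightTable} {e : List V} (hR : wellFormed R) (he : e.length = R.length)
    {c : List ℤ × List (ℕ × Weight)} {L : List (List ℤ × WeightTable)}
    (hL : sumFlat R c = some L) :
    (∑ x, eval t c.1 * (c.2.map fun b => (e[b.1]?).elim 1 (b.2.entry T t x)).prod) *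
      tableVal T t R e = (L.map fun b => eval t b.1 * tableVal T t b.2 e).sum := by
  unfold sumFlat at hL
  split at hL
  · simp only [Option.some.injEq] at hL
    subst hL; simp
  · simp only [Option.some.injEq] at hL
    subst hL
    simp only [List.map_nil, List.prod_nil, mul_one, Finset.sum_const, Finset.card_univ, hn,
      List.map_cons, List.sum_cons, List.sum_nil, eval_mul, eval_list_cons, eval_nil, nsmul_eq_mul]
    push_cast; ring
  · split_ifs at hL with hp
    simp only [Option.some.injEq] at hL
    subst hL
    rename_i p s _
    obtain ⟨y, hy⟩ : ∃ y, e[p]? = some y := ⟨_, List.getElem?_eq_getElem (by omega)⟩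
    simp only [List.map_cons, List.map_nil, List.prod_cons, List.prod_nil, hy, Option.elim_some,
      mul_one, ← Finset.mul_sum, List.sum_cons, List.sum_nil, eval_mul, sum_entry hT hn]
    ring
  · split_ifs at hL with hp
    simp only [Option.some.injEq] at hL
    subst hL
    rename_i p s q r _
    obtain ⟨y, hy⟩ : ∃ y, e[p]? = some y := ⟨_, List.getElem?_eq_getElem (by omega)⟩
    obtain ⟨z, hz⟩ : ∃ z, e[q]? = some z := ⟨_, List.getElem?_eq_getElem (by omega)⟩
    have h := sum_entry_mul_entry hT hn s.transpose r y z
    simp only [entry_transpose hT.1.1] at h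
    simp only [List.map_cons, List.map_nil, List.prod_cons, List.prod_nil, hy, hz,
      Option.elim_some, mul_one, ← Finset.mul_sum, List.sum_cons, List.sum_nil,
      tableVal_mulPair hR hp.1 hp.2 hy hz, h]
    ring
  · simp at hL

theorem length_of_mem_contractions {row : List Weight} {b : List ℤ × ℕ × List Weight}
    (hb : b ∈ contractions row) : b.2.1 < row.length ∧ b.2.2.length = row.length := by
  induction row generalizing b with
  | nil => simp [contractions] at hb
  | cons s row ih =>
    have key : ∀ b ∈ (contractions row).map fun b => (b.1, b.2.1 + 1, s.flatten :: b.2.2),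
        b.2.1 < (s :: row).length ∧ b.2.2.length = (s :: row).length := by
      intro b hb
      obtain ⟨b', hb', rfl⟩ := List.mem_map.1 hb
      simpa using ih hb'
    rw [contractions] at hb
    split_ifs at hb
    · rcases List.mem_cons.1 hb with rfl | hb
      · simp
      · exact key b hb
    · exact key b hb

omit [Fintype V] in
theorem sum_list_map_sum {α β : Type*} (S : Finset α) (L : List β) (f : α → β → ℤ) :
    ∑ x ∈ S, (L.map (f x)).sum = (L.map fun b => ∑ x ∈ S, f x b).sum := by
  induction L with
  | nil => simp
  | cons b L ih => simp [Finset.sum_add_distrib, ih]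

/-- In a contraction term the diagonal factor forces `x` to be an older vertex, so the sum collapses
to one absorbed row. The all-flat term is `sum_sumFlat`. -/
theorem sum_eliminate (hT : T.IsDoublyRegularTournament) (hn : Fintype.card V = 4 * t + 3)
    {R : WeightTable} {e : List V} (hR : wellFormed R) (he : e.length + 1 = R.length)
    {L : List (List ℤ × WeightTable)} (hL : eliminate R = some L) :
    ∑ x, tableVal T t R (x :: e) = (L.map fun b => eval t b.1 * tableVal T t b.2 e).sum := by
  classical
  match R, hL, hR, he with
  | row :: R, hL, hR, he =>
    obtain ⟨L', hL', rfl⟩ := Option.map_eq_some_iff.1 hL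
    obtain ⟨hrow, hR⟩ := wellFormed_cons.1 hR
    have he : e.length = R.length := by simpa using he
    simp only [tableVal, ← Finset.sum_mul]
    simp only [rowVal_eq_contractions row _ e, rowVal_flatten row _ e (he.trans hrow.symm)]
    rw [Finset.sum_add_distrib, add_mul, sum_sumFlat hT hn hR he hL', List.map_append,
      List.sum_append, List.map_map]
    congr 1
    rw [sum_list_map_sum, ← List.sum_map_mul_right]
    congr 1
    refine List.map_congr_left fun b hb => ?_
    obtain ⟨hb1, hb2⟩ := length_of_mem_contractions hb
    obtain ⟨y, hy⟩ : ∃ y, e[b.2.1]? = some y := ⟨_, List.getElem?_eq_getElem (by omega)⟩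
    simp only [Function.comp_apply, tableVal_absorb hT.1.1 hR (hb2.trans hrow) he hy, hy,
      Option.some.injEq, mul_ite, mul_zero, Finset.sum_ite_eq, Finset.mem_univ, if_true]
    ring

/-- Sum over the `k` newest vertices of a stack. -/
def stackSum (k : ℕ) (f : List V → ℤ) (e : List V) : ℤ := ∑ g : Fin k → V, f (List.ofFn g ++ e)

/-- The newest vertex becomes the innermost sum, so it can be eliminated with all older vertices
fixed. -/
theorem stackSum_succ (k : ℕ) (f : List V → ℤ) (e : List V) :
    stackSum (k + 1) f e = stackSum k (fun e => ∑ x, f (x :: e)) e := by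
  unfold stackSum
  rw [← (Fin.consEquiv fun _ => V).sum_comp, Fintype.sum_prod_type, Finset.sum_comm]
  simp [Fin.consEquiv]

theorem stackSum_congr {k : ℕ} {f g : List V → ℤ} {e : List V}
    (h : ∀ e' : List V, e'.length = k + e.length → f e' = g e') :
    stackSum k f e = stackSum k g e :=
  Finset.sum_congr rfl fun _ _ => h _ (by simp)

theorem stackSum_list_sum (k : ℕ) (L : List (List ℤ × WeightTable)) (t : ℤ) (e : List V) :
    stackSum k (fun e => (L.map fun b => eval t b.1 * tableVal T t b.2 e).sum) e =
      (L.map fun b => eval t b.1 * stackSum k (tableVal T t b.2) e).sum := by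
  simp only [stackSum, sum_list_map_sum, Finset.mul_sum]

theorem stackSum_swapTop (hT : T.IsTournament) (t : ℤ) (k : ℕ) (R : WeightTable) (e : List V) :
    stackSum (k + 2) (tableVal T t (swapTop R)) e = stackSum (k + 2) (tableVal T t R) e := by
  unfold swapTop
  split
  · simp only [stackSum_succ]
    refine stackSum_congr fun e' _ => ?_
    rw [Finset.sum_comm]
    simp only [tableVal, rowVal, entry_transpose hT]
    refine Finset.sum_congr rfl fun x _ => Finset.sum_congr rfl fun y _ => ?_
    ring
  · rfl

theorem stackSum_rotateTop (hT : T.IsTournament) (t : ℤ) (k : ℕ) (R : WeightTable)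
    (e : List V) :
    stackSum (k + 3) (tableVal T t (rotateTop R)) e = stackSum (k + 3) (tableVal T t R) e := by
  unfold rotateTop
  split
  · simp only [stackSum_succ]
    refine stackSum_congr fun e' _ => ?_
    conv_rhs => rw [Finset.sum_comm]; enter [2, x]; rw [Finset.sum_comm]
    rw [Finset.sum_comm]
    conv_rhs => rw [Finset.sum_comm]
    simp only [tableVal, rowVal, entry_transpose hT]
    refine Finset.sum_congr rfl fun x _ => Finset.sum_congr rfl fun y _ =>
      Finset.sum_congr rfl fun z _ => ?_
    ring
  · rfl

theorem stackSum_rearrange (hT : T.IsTournament) (t : ℤ) (k : ℕ) (R : WeightTable)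
    (e : List V) :
    stackSum (k + 1) (tableVal T t (rearrange k R)) e = stackSum (k + 1) (tableVal T t R) e := by
  unfold rearrange
  split_ifs with h1 h2
  · rfl
  · obtain ⟨k, rfl⟩ := Nat.exists_eq_succ_of_ne_zero (not_or.1 h1).2
    exact stackSum_swapTop hT t k R e
  · obtain ⟨k, rfl⟩ : ∃ m, k = m + 2 := ⟨k - 2, by omega⟩
    exact stackSum_rotateTop hT t k R e

omit [Fintype V] in
theorem rowVal_eq_zero {t : ℤ} {r : List Weight} {x : V} {e : List V} (he : e.length = r.length)
    (h : (⟨[], [], []⟩ : Weight) ∈ r) : rowVal T t r x e = 0 := by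
  induction r generalizing e with
  | nil => simp at h
  | cons s r ih =>
    match e, he with
    | y :: e, he =>
      rw [rowVal]
      rcases List.mem_cons.1 h with rfl | h
      · simp [entry]
      · rw [ih (by simpa using he) h, mul_zero]

omit [Fintype V] in
theorem tableVal_eq_zero {t : ℤ} {R : WeightTable} {e : List V} (he : e.length = R.length)
    (hR : wellFormed R) (h : hasZero R) : tableVal T t R e = 0 := by
  induction R generalizing e with
  | nil => simp [hasZero] at h
  | cons r R ih =>
    match e, he with
    | x :: e, he =>
      obtain ⟨hr, hR⟩ := wellFormed_cons.1 hR
      have he : e.length = R.length := by simpa using he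
      rw [tableVal]
      by_cases h' : (⟨[], [], []⟩ : Weight) ∈ r
      · rw [rowVal_eq_zero (he.trans hr.symm) h', zero_mul]
      · rw [ih he hR, mul_zero]
        simpa [hasZero, h'] using h

theorem length_rearrange (k : ℕ) (R : WeightTable) : (rearrange k R).length = R.length := by
  have h1 : (swapTop R).length = R.length := by unfold swapTop; split <;> rfl
  have h2 : (rotateTop R).length = R.length := by unfold rotateTop; split <;> rfl
  unfold rearrange
  split_ifs <;> simp [h1, h2]

theorem length_mulPair (p q : ℕ) (s : Weight) (R : WeightTable) :
    (mulPair p q s R).length = R.length := by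
  induction p generalizing q R with
  | zero => cases q <;> cases R <;> simp [mulPair]
  | succ p ih => cases q <;> cases R <;> simp [mulPair, ih]

theorem length_absorb (j : ℕ) (row : List Weight) (R : WeightTable) :
    (absorb j row R).length = R.length := by
  induction j generalizing row R with
  | zero => cases row <;> cases R <;> simp [absorb]
  | succ j ih => cases row <;> cases R <;> simp [absorb, ih]

theorem length_of_eliminate {R : WeightTable} {L : List (List ℤ × WeightTable)}
    (hL : eliminate R = some L) : ∀ b ∈ L, b.2.length + 1 = R.length := by
  match R, hL with
  | row :: R, hL =>
    obtain ⟨L', hL', rfl⟩ := Option.map_eq_some_iff.1 hL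
    intro b hb
    rcases List.mem_append.1 hb with hb | hb
    · obtain ⟨c, -, rfl⟩ := List.mem_map.1 hb
      simp [length_absorb]
    · unfold sumFlat at hL'
      split at hL' <;> (try split_ifs at hL') <;> simp at hL' <;> subst hL' <;>
        simp_all [length_mulPair]

theorem stackSum_eq_evaluate (hT : T.IsDoublyRegularTournament)
    (hn : Fintype.card V = 4 * t + 3) {u v : V} (huv : T.Adj u v) {k : ℕ} {R : WeightTable}
    (hR : R.length = k + 2) {p : List ℤ} (hp : evaluate k R = some p) :
    stackSum k (tableVal T t R) [v, u] = eval t p := by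
  induction k generalizing R p with
  | zero =>
    unfold evaluate at hp
    split at hp <;> first | (exfalso; omega) | simp at hp
    subst hp
    simp [stackSum, tableVal, rowVal, entry, (hT.1.1.ne_of_adj huv).symm,
      hT.1.1.not_adj_of_adj huv]
  | succ k ih =>
    rw [evaluate] at hp
    dsimp only at hp
    split_ifs at hp with hwf hz hwf'
    · obtain rfl : p = [] := by simpa using hp.symm
      refine Finset.sum_eq_zero fun g _ => tableVal_eq_zero (by simp; omega) hwf hz
    · obtain ⟨L, hL, hLp⟩ := Option.bind_eq_some_iff.1 hp
      rw [← stackSum_rearrange hT.1.1, stackSum_succ]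
      have hlen := length_rearrange k R
      have hL' := length_of_eliminate hL
      rw [stackSum_congr (fun e' he' => sum_eliminate hT hn hwf' (by simp at he'; omega) hL),
        stackSum_list_sum]
      clear hL hp
      induction L generalizing p with
      | nil => simp_all
      | cons b L ihL =>
        simp only [List.foldr_cons, Option.bind_eq_some_iff, Option.map_eq_some_iff] at hLp
        obtain ⟨q, hq, r, hr, rfl⟩ := hLp
        rw [List.map_cons, List.sum_cons, ihL hr (fun b hb => hL' b (List.mem_cons_of_mem _ hb)),
          ih (by have := hL' b List.mem_cons_self; omega) hq]
        simp

end

/-! ### Products of weights as indicators of paths and cycles. -/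

open Classical in
theorem entry_coarc (hT : T.IsTournament) (x y : V) :
    coarc.entry T t x y = if T.Adj y x then 1 else 0 := by
  by_cases hxy : x = y
  · subst hxy; simp [entry, coarc, hT.1 x]
  · have := hT.2 x y hxy
    by_cases h : T.Adj x y <;> simp_all [entry, coarc]

open Classical in
theorem entry_arc (hT : T.IsTournament) (x y : V) :
    arc.entry T t x y = if T.Adj x y then 1 else 0 := by
  by_cases hxy : x = y
  · subst hxy; simp [entry, arc, hT.1 x]
  · by_cases h : T.Adj x y <;> simp_all [entry, arc]

open Classical in
theorem rowVal_replicate_distinct (x : V) (e : List V) :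
    rowVal T t (List.replicate e.length distinct) x e = if x ∉ e then 1 else 0 := by
  induction e with
  | nil => simp [rowVal]
  | cons y e ih =>
    rw [List.length_cons, List.replicate_succ, rowVal, ih]
    by_cases hxy : x = y <;> by_cases h : x ∈ e <;> simp [entry, distinct, hxy, h]

theorem rowVal_append {r : List Weight} {x : V} {e : List V} (h : r.length = e.length)
    (r' : List Weight) (e' : List V) :
    rowVal T t (r ++ r') x (e ++ e') = rowVal T t r x e * rowVal T t r' x e' := by
  induction r generalizing e with
  | nil =>
    obtain rfl : e = [] := by simpa [eq_comm] using h
    simp [rowVal]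
  | cons s r ih =>
    match e, h with
    | y :: e, h =>
      simp only [List.cons_append, rowVal, ih (e := e) (by simpa using h), mul_assoc]

open Classical in
theorem tableVal_pathTable (hT : T.IsTournament) {k : ℕ} {e : List V} (he : e.length = k + 1) :
    tableVal T t (pathTable k) e =
      if e.Nodup ∧ e.IsChain (fun a b => T.Adj b a) then 1 else 0 := by
  induction k generalizing e with
  | zero =>
    match e, he with
    | [x], _ => simp [pathTable, tableVal, rowVal]
  | succ k ih =>
    match e, he with
    | x :: y :: e, he =>
      have hk : k = e.length := by simp at he; omega
      subst hk
      rw [pathTable, tableVal, rowVal, rowVal_replicate_distinct, entry_coarc hT, ih (by simp)]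
      simp only [List.nodup_cons, List.isChain_cons_cons, List.mem_cons]
      by_cases h : T.Adj y x
      -- Distinctness from the neighbour `y` is implied by the arc, so its weight is `coarc` alone.
      · have := (hT.ne_of_adj h).symm
        by_cases hx : x ∈ e <;> simp [h, hx, this]
      · simp [h]

open Classical in
-- Stacks run against the arcs. Repeating the oldest vertex `z` in front encodes the closing arc
-- from the newest vertex to `z`.
theorem tableVal_cycleTable (hT : T.IsTournament) {k : ℕ} {e : List V} (he : e.length = k + 2)
    (z : V) :
    tableVal T t (cycleTable k) (e ++ [z]) =
      if (e ++ [z]).Nodup ∧ (z :: (e ++ [z])).IsChain (fun a b => T.Adj b a) then 1 else 0 := by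
  match e, he with
  | x :: y :: e, he =>
    have hk : k = e.length := by simp at he; omega
    subst hk
    simp only [List.cons_append]
    rw [cycleTable, tableVal, rowVal, rowVal_append (by simp), rowVal_replicate_distinct,
      entry_coarc hT, tableVal_pathTable hT (by simp), rowVal, entry_arc hT, rowVal]
    · simp only [List.nodup_cons, List.isChain_cons_cons, List.mem_cons, List.mem_append]
      by_cases h : T.Adj y x <;> by_cases h' : T.Adj x z
      · have h1 := (hT.ne_of_adj h).symm
        have h2 := hT.ne_of_adj h'
        by_cases hx : x ∈ e <;> simp [h, h', hx, h1, h2]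
      all_goals simp [h, h']
    all_goals simp

end WeightTable

/-! ### Cyclic sequences with a chosen starting point. -/

namespace Cycle

variable {α : Type*}

/-- Without repetitions, a rotation that keeps the first entry is trivial. -/
theorem eq_of_coe_cons_eq {a : α} {l l' : List α} (hl : (a :: l).Nodup)
    (h : ((a :: l : List α) : Cycle α) = (a :: l' : List α)) : l = l' := by
  obtain ⟨n, hn, h⟩ := List.isRotated_iff_mod.1 (Cycle.coe_eq_coe.1 h)
  rcases hn.lt_or_eq with hn | rfl
  · have h0 := List.head?_rotate hn
    rw [h, List.head?_cons] at h0
    have h1 : (a :: l)[0]? = (a :: l)[n]? := by simpa using h0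
    rw [List.getElem?_inj (by simp) hl] at h1
    subst h1
    simpa using h
  · simpa using h

theorem exists_eq_coe_cons {c : Cycle α} {a : α} (h : a ∈ c) :
    ∃ l : List α, c = ((a :: l : List α) : Cycle α) := by
  induction c using Quotient.inductionOn' with
  | h l =>
    obtain ⟨s, r, rfl⟩ := List.append_of_mem (show a ∈ l from h)
    exact ⟨r ++ s, Cycle.coe_eq_coe.2 (List.isRotated_append (l := s) (l' := a :: r))⟩

/-- A cyclic sequence of distinct entries has as many consecutive pairs as entries. -/
theorem ncard_consecutive {c : Cycle α} (hc : c.Nodup) (hlen : 2 ≤ c.length) :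
    {p : α × α | ∃ l : List α, c = ((p.1 :: p.2 :: l : List α) : Cycle α)}.ncard = c.length := by
  classical
  have h1 : c.toFinset.card = c.length := by
    induction c using Quotient.inductionOn' with
    | h l => exact List.toFinset_card_of_nodup hc
  have h2 : ∀ a, a ∈ c.toFinset ↔ a ∈ c := by
    induction c using Quotient.inductionOn' with
    | h l => exact fun a => List.mem_toFinset
  rw [← h1, ← Set.ncard_coe_finset]
  refine Set.ncard_congr (fun p _ => p.1) ?_ ?_ ?_
  · rintro ⟨a, b⟩ ⟨l, rfl⟩
    simp
  · rintro ⟨a, b⟩ ⟨a', b'⟩ ⟨l, hl⟩ ⟨l', hl'⟩ (rfl : a = a')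
    subst hl
    have := eq_of_coe_cons_eq (by simpa using hc) hl'
    simp_all
  · intro a ha
    obtain ⟨l, rfl⟩ := exists_eq_coe_cons (c := c) (a := a) ((h2 a).1 ha)
    match l, hlen with
    | b :: l, _ => exact ⟨(a, b), ⟨l, rfl⟩, rfl⟩
    | [], h => simp at h

end Cycle

/-! ### From weighted sums to numbers of cycles. -/

namespace Digraph

open WeightTable

variable {V : Type*} [Fintype V] {T : Digraph V}

theorem finite_cyclesOfLength (T : Digraph V) (m : ℕ) : (T.cyclesOfLength m).Finite := by
  classical
  exact
    (Set.finite_coe_iff.1 (inferInstanceAs (Finite {c : Cycle V // c.Nodup}))).subset fun c hc => hc.1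

/-- A cycle through the arc is `u :: v :: l` for a unique `l`. Its stack lists `l` reversed, above
`v` and `u`, and the table value is the indicator of such a cycle. -/
theorem ncard_cyclesThroughArc_eq_stackSum (hT : T.IsTournament) (t : ℤ) (k : ℕ) (u v : V) :
    ((T.cyclesThroughArc (k + 3) u v).ncard : ℤ) =
      stackSum (k + 1) (tableVal T t (cycleTable k)) [v, u] := by
  classical
  have himage : T.cyclesThroughArc (k + 3) u v =
      (fun g : Fin (k + 1) → V => ((u :: v :: (List.ofFn g).reverse : List V) : Cycle V)) ''
        {g | (List.ofFn g ++ [v] ++ [u]).Nodup ∧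
          (u :: (List.ofFn g ++ [v] ++ [u])).IsChain fun a b => T.Adj b a} := by
    have hiff : ∀ g : Fin (k + 1) → V, ((List.ofFn g ++ [v] ++ [u]).Nodup ∧
          (u :: (List.ofFn g ++ [v] ++ [u])).IsChain fun a b => T.Adj b a) ↔
        ((u :: v :: (List.ofFn g).reverse : List V) : Cycle V) ∈ T.cyclesOfLength (k + 3) := by
      intro g
      rw [cyclesOfLength, Set.mem_ofPred_eq, Cycle.nodup_coe_iff, Cycle.chain_coe_cons,
        ← List.nodup_reverse, ← List.isChain_reverse]
      simp
    ext c
    simp only [cyclesThroughArc, Set.mem_image, Set.mem_ofPred_eq, hiff]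
    constructor
    · rintro ⟨hc, l, rfl⟩
      have hlen : l.reverse.length = k + 1 := by
        have := hc.2.1
        simpa using this
      obtain ⟨g, hg⟩ : ∃ g : Fin (k + 1) → V, List.ofFn g = l.reverse := by
        rw [← hlen]
        exact ⟨l.reverse.get, List.ofFn_get _⟩
      refine ⟨g, ?_, ?_⟩ <;> rw [hg, List.reverse_reverse]
      exact hc
    · rintro ⟨g, hg, rfl⟩
      exact ⟨hg, _, rfl⟩
  rw [himage, Set.InjOn.ncard_image]
  · rw [Set.ncard_eq_toFinset_card', stackSum, Finset.card_eq_sum_ones]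
    push_cast
    simp only [Set.toFinset_ofPred, Finset.sum_filter]
    refine Finset.sum_congr rfl fun g _ => ?_
    rw [show List.ofFn g ++ [v, u] = List.ofFn g ++ [v] ++ [u] by simp,
      tableVal_cycleTable hT (by simp)]
  · rintro g ⟨hg, -⟩ g' - h
    have hnd : (u :: v :: (List.ofFn g).reverse).Nodup := by
      rw [← List.nodup_reverse]; simpa using hg
    exact List.ofFn_injective
      (List.reverse_injective (List.cons.inj (Cycle.eq_of_coe_cons_eq hnd h)).2)

omit [Fintype V] in
theorem adj_of_mem_cyclesThroughArc {m : ℕ} {u v : V} {c : Cycle V}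
    (hc : c ∈ T.cyclesThroughArc m u v) : T.Adj u v := by
  obtain ⟨⟨-, -, h⟩, l, rfl⟩ := hc
  rw [Cycle.chain_coe_cons] at h
  exact (List.isChain_cons_cons.1 h).1

/-- Counting the pairs of a cycle and an arc on it in two ways. -/
theorem sum_ncard_cyclesThroughArc (T : Digraph V) {m : ℕ} (hm : 2 ≤ m) :
    ∑ p : V × V, (T.cyclesThroughArc m p.1 p.2).ncard = m * (T.cyclesOfLength m).ncard := by
  classical
  have hfin := T.finite_cyclesOfLength m
  have h := Finset.sum_card_bipartiteAbove_eq_sum_card_bipartiteBelow (s := Finset.univ)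
    (t := hfin.toFinset) (fun (p : V × V) (c : Cycle V) =>
      ∃ l : List V, c = ((p.1 :: p.2 :: l : List V) : Cycle V))
  have h1 : ∀ p : V × V, (hfin.toFinset.bipartiteAbove (fun (p : V × V) (c : Cycle V) =>
      ∃ l : List V, c = ((p.1 :: p.2 :: l : List V) : Cycle V)) p).card =
      (T.cyclesThroughArc m p.1 p.2).ncard := by
    intro p
    rw [← Set.ncard_coe_finset]
    congr 1
    ext c
    simp [Finset.bipartiteAbove, cyclesThroughArc]
  have h2 : ∀ c ∈ hfin.toFinset, (Finset.univ.bipartiteBelow (fun (p : V × V) (c : Cycle V) =>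
      ∃ l : List V, c = ((p.1 :: p.2 :: l : List V) : Cycle V)) c).card = m := by
    intro c hc
    obtain ⟨hnd, hlen, -⟩ := hfin.mem_toFinset.1 hc
    rw [← Set.ncard_coe_finset]
    refine Eq.trans ?_ ((Cycle.ncard_consecutive hnd (hlen ▸ hm)).trans hlen)
    congr 1
    ext p
    simp [Finset.bipartiteBelow]
  rw [Finset.sum_congr rfl fun p _ => h1 p, Finset.sum_congr rfl h2] at h
  rw [h, Finset.sum_const, smul_eq_mul, mul_comm, Set.ncard_eq_toFinset_card _ hfin]

variable {t : ℕ}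

theorem IsDoublyRegularTournament.ncard_cyclesThroughArc_eight
    (hT : T.IsDoublyRegularTournament) (hn : Fintype.card V = 4 * t + 3) {u v : V}
    (huv : T.Adj u v) :
    ((T.cyclesThroughArc 8 u v).ncard : ℤ) =
      2 * ((t : ℤ) + 1) * ((t : ℤ) - 1) * (t : ℤ) ^ 2
        * (16 * (t : ℤ) ^ 2 - 4 * (t : ℤ) - 11) := by
  rw [ncard_cyclesThroughArc_eq_stackSum hT.1.1 t 5 u v,
    stackSum_eq_evaluate hT hn huv rfl evaluate_cycleTable]
  simp only [CoeffList.eval_list_cons, CoeffList.eval_nil]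
  ring

theorem IsRegularTournament.card_arcs (hT : T.IsRegularTournament)
    (hn : Fintype.card V = 4 * t + 3) :
    {p : V × V | T.Adj p.1 p.2}.ncard = (4 * t + 3) * (2 * t + 1) := by
  classical
  rw [Set.ncard_eq_toFinset_card', Set.toFinset_ofPred, Finset.card_filter,
    Fintype.sum_prod_type]
  have : ∀ u, (∑ v, if T.Adj u v then 1 else 0) = 2 * t + 1 := by
    intro u
    rw [← hT.ncard_outSet hn u, outSet, Set.ncard_eq_toFinset_card', Set.toFinset_ofPred,
      Finset.card_filter]
  simp [this, hn]

theorem IsDoublyRegularTournament.eight_mul_ncard_cyclesOfLength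
    (hT : T.IsDoublyRegularTournament) (hn : Fintype.card V = 4 * t + 3) :
    8 * ((T.cyclesOfLength 8).ncard : ℤ) = (4 * t + 3) * (2 * t + 1) *
      (2 * ((t : ℤ) + 1) * ((t : ℤ) - 1) * (t : ℤ) ^ 2
        * (16 * (t : ℤ) ^ 2 - 4 * (t : ℤ) - 11)) := by
  classical
  have h1 := T.sum_ncard_cyclesThroughArc (m := 8) (by norm_num)
  have h2 := hT.1.card_arcs hn
  rw [Set.ncard_eq_toFinset_card', Set.toFinset_ofPred] at h2
  have h3 : ∀ p : V × V, ((T.cyclesThroughArc 8 p.1 p.2).ncard : ℤ) = if T.Adj p.1 p.2 then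
      (2 * ((t : ℤ) + 1) * ((t : ℤ) - 1) * (t : ℤ) ^ 2
        * (16 * (t : ℤ) ^ 2 - 4 * (t : ℤ) - 11)) else 0 := by
    intro p
    split_ifs with hp
    · exact hT.ncard_cyclesThroughArc_eight hn hp
    · rw [Set.eq_empty_of_forall_notMem fun c hc => hp (adj_of_mem_cyclesThroughArc hc)]
      simp
  have h4 := congrArg (Nat.cast : ℕ → ℤ) h1
  push_cast at h4
  rw [← h4, Finset.sum_congr rfl fun p _ => h3 p, ← Finset.sum_filter, Finset.sum_const, h2]
  simp

end Digraph

theorem theorem1 (t : ℕ) :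
    (∀ (V : Type*) [Fintype V] (T : Digraph V),
      T.IsDoublyRegularTournament → Fintype.card V = 4 * t + 3 →
        ∀ u v : V, T.Adj u v →
          (((T.cyclesThroughArc 8 u v).ncard : ℤ) =
            2 * ((t : ℤ) + 1) * ((t : ℤ) - 1) * (t : ℤ) ^ 2
              * (16 * (t : ℤ) ^ 2 - 4 * (t : ℤ) - 11)) ∧
          (((T.cyclesThroughArc 8 u v).ncard : ℚ) =
            2 * 8 * ((T.cyclesOfLength 8).ncard : ℚ)
              / ((4 * (t : ℚ) + 3) * ((4 * (t : ℚ) + 3) - 1)))) ∧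
    (∀ (V W : Type*) [Fintype V] [Fintype W] (T : Digraph V) (S : Digraph W),
      T.IsDoublyRegularTournament → S.IsDoublyRegularTournament →
        Fintype.card V = 4 * t + 3 → Fintype.card W = 4 * t + 3 →
          (T.cyclesOfLength 8).ncard = (S.cyclesOfLength 8).ncard) := by
  refine ⟨fun V _ T hT hn u v huv => ?_, fun V W _ _ T S hT hS hV hW => ?_⟩
  · have h1 := hT.ncard_cyclesThroughArc_eight hn huv
    refine ⟨h1, ?_⟩
    have h2 := hT.eight_mul_ncard_cyclesOfLength hn
    rw [← h1] at h2
    have h3 := congrArg (Int.cast : ℤ → ℚ) h2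
    push_cast at h3
    have h4 : (4 * (t : ℚ) + 3) * ((4 * (t : ℚ) + 3) - 1) ≠ 0 := by
      have : (0 : ℚ) ≤ t := Nat.cast_nonneg t
      refine mul_ne_zero ?_ ?_ <;> intro h <;> linarith
    rw [eq_div_iff h4]
    -- The factor `2` comes from `n - 1 = 2 * (2t + 1)`.
    linear_combination -2 * h3
  · have h1 := hT.eight_mul_ncard_cyclesOfLength hV
    rw [← hS.eight_mul_ncard_cyclesOfLength hW] at h1
    omega
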